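/- A complex atomic Radon measure on $\mathbb{R}^d$ is a measure $\nu=\sum_{\lambda\in\Lambda}\nu(\lambda)\delta_\lambda$ with $\Lambda\subset\mathbb{R}^d$ countable, $\nu(\lambda)\in\mathbb{C}$ for $\lambda\in\Lambda$, and $\sum_{\lambda\in\Lambda\cap K}|\nu(\lambda)|<\infty$ for every compact $K$. It is translation bounded if $\sup_{t\in\mathbb{R}^d}\sum_{\lambda\in\Lambda,\,|\lambda-t|<1}|\nu(\lambda)|<\infty$. Such a measure is identified with the tempered distribution $\varphi\mapsto\sum_{\lambda\in\Lambda}\nu(\lambda)\varphi(\lambda)$, and the Fourier transform of a tempered distribution is defined by $\hat f(\varphi)=f(\hat\varphi)$ for Schwartz functions $\varphi$, where $\hat\varphi(y)=\int_{\mathbb{R}^d}\varphi(x)e^{-2\pi i\langle x,y\rangle}\,dx$. A set $U\subset\mathbb{R}^d$ is uniformly discrete if $\inf\{|x-x'|: x,x'\in U,\ x\ne x'\}>0$. It is a coherent set of frequencies if it is uniformly discrete and every limit, uniform on each compact subset of $\mathbb{R}^d$, of a sequence of finite sums $\sum c_\lambda e^{2\pi i\langle x,\lambda\rangle}$ with $\lambda\in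 U$, $c_\lambda\in\mathbb{C}$, is almost periodic in the sense of Bohr. (A function $f:\mathbb{R}^d\to\mathbb{C}$ is Bohr almost periodic if it is continuous and for every $\eta>0$ there is $R>0$ such that every ball of radius $R$ contains a $\tau$ with $\sup_{x\in\mathbb{R}^d}|f(x+\tau)-f(x)|\le\eta$.) Theorem. Let $\mu=\sum_{\lambda\in\Lambda}\mu(\lambda)\delta_\lambda$ be a translation bounded atomic measure on $\mathbb{R}^d$ which is a tempered distribution and whose Fourier transform $\hat\mu$ is also a translation bounded atomic measure. Let $U\subset\Lambda$ and $\varepsilon>0$ be such that for all $\lambda\in U$ (i) $|\mu(\lambda)|\ge\varepsilon$, and (ii) $|\lambda-\lambda'|\ge\varepsilon$ for all $\lambda'\in\Lambda\setminus\{\lambda\}$. Then $U$ is a coherent set of frequencies. -/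

import Mathlib

open scoped FourierTransform SchwartzMap RealInnerProductSpace

noncomputable section

namespace Quasicrystal

/-- The Euclidean space `ℝ^d`. -/
abbrev E (d : ℕ) : Type := EuclideanSpace ℝ (Fin d)

/-- A complex atomic Radon measure `∑_{x ∈ Λ} c_x δ_x` on `ℝ^d`: a countable set `Λ` (`carrier`) and
masses `c_x` (`coeff`, set to zero off `Λ`), with finite total variation on every compact set.
Masses at points of `Λ` are allowed to vanish. -/
structure AtomicMeasure (d : ℕ) where
  carrier : Set (E d)
  countable_carrier : carrier.Countable
  coeff : E d → ℂ
  coeff_eq_zero : ∀ x, x ∉ carrier → coeff x = 0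
  locallyFinite : ∀ K : Set (E d), IsCompact K → Summable fun x : K => ‖coeff x‖

namespace AtomicMeasure

variable {d : ℕ}

/-- The variation `|ν| = ∑_{x ∈ Λ} |c_x| δ_x`, a positive Borel measure. -/
def variation (ν : AtomicMeasure d) : MeasureTheory.Measure (E d) :=
  MeasureTheory.Measure.sum fun x : ν.carrier =>
    ‖ν.coeff x‖ₑ • MeasureTheory.Measure.dirac (x : E d)

/-- The variation of all unit balls is bounded by one finite constant. -/
def TranslationBounded (ν : AtomicMeasure d) : Prop :=
  ∃ C : NNReal, ∀ t : E d, ν.variation (Metric.ball t 1) ≤ (C : ENNReal)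

/-- The measure `ν` is the tempered distribution `T`: `T(φ) = ∫ φ dν = ∑_x c_x φ(x)` for every
Schwartz function `φ`, the sum converging absolutely. -/
def IsDistribution (ν : AtomicMeasure d) (T : 𝓢'(E d, ℂ)) : Prop :=
  ∀ φ : 𝓢(E d, ℂ), HasSum (fun x : E d => ν.coeff x * φ x) (T φ)

end AtomicMeasure

/-- Distinct points of `U` have distances bounded below by a positive number. -/
def UniformlyDiscrete {d : ℕ} (U : Set (E d)) : Prop :=
  ∃ r : ℝ, 0 < r ∧ ∀ x ∈ U, ∀ y ∈ U, x ≠ y → r ≤ dist x y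

/-- `P` is a finite sum `∑ c_u exp(2πi⟨x, u⟩)` with `u ∈ U` and complex coefficients. -/
def IsExpSum {d : ℕ} (U : Set (E d)) (P : E d → ℂ) : Prop :=
  ∃ (s : Finset (E d)) (c : E d → ℂ), (∀ u ∈ s, u ∈ U) ∧
    ∀ x, P x = ∑ u ∈ s, c u * Complex.exp (2 * Real.pi * Complex.I * (⟪x, u⟫ : ℝ))

/-- Almost periodicity in the sense of Bohr: `f` is continuous and, for every `ε > 0`, its
`ε`-almost periods are relatively dense, that is, they meet every ball of some radius `R`. -/
def IsBohrAlmostPeriodic {d : ℕ} (f : E d → ℂ) : Prop :=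
  Continuous f ∧ ∀ ε : ℝ, 0 < ε → ∃ R : ℝ, 0 < R ∧ ∀ a : E d, ∃ τ ∈ Metric.ball a R,
    ∀ x : E d, ‖f (x + τ) - f x‖ ≤ ε

/-- Coherent set of frequencies: `U` is uniformly discrete, and every limit, uniform on each
compact set, of a sequence of finite exponential sums with frequencies in `U` is Bohr almost
periodic. -/
def IsCoherentSetOfFrequencies {d : ℕ} (U : Set (E d)) : Prop :=
  UniformlyDiscrete U ∧
    ∀ (P : ℕ → E d → ℂ) (f : E d → ℂ), (∀ n, IsExpSum U (P n)) →
      (∀ K : Set (E d), IsCompact K → TendstoUniformlyOn P f Filter.atTop K) →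
      IsBohrAlmostPeriodic f

end Quasicrystal

end

/-! The point is that for exponential sums `P` with frequencies in `U`, the sup norm on the whole
space is at most a constant times the sup norm on one fixed ball (`exists_norm_expSum_le`). A
sequence of such sums converging uniformly on compact sets then converges uniformly on `ℝ^d`, and
uniform limits of exponential sums are Bohr almost periodic.

For `P = ∑ c_u e_u` put `Q = ∑ c_u μ(u) e_u`. Testing `μ` against a bump of radius `ε` around `u`,
modulated by an exponential, isolates the mass at `u`. On the dual side this reads `Q(x) = ∑_γ
μhat(γ) κ(x+γ) P(x+γ)` with one Schwartz function `κ` for all `u` (`exists_schwartz_hasSum`). As `κ`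
decays and `μhat` is translation bounded, `‖Q‖_∞ ≤ A (M + N / (1 + R))`, where `M` bounds `|P|` on
the ball of radius `R` and `N` bounds it everywhere (`exists_norm_sum_coeff_le`).

Conversely, `x = 0` exhibits `μ(u)` as an absolutely convergent series `∑ ν(γ) e_u(γ)`. So `P ↦ Q`
is the combination `∑ ν(γ) τ_γ` of translations, with eigenvalues at least `ε` in modulus. A Wiener
lemma (`isUnit_tsum_smul_of_le_norm`) inverts it on the closed span of the exponentials of `U`,
whence `N ≤ G ‖Q‖_∞`. For `R` large the term `N / (1 + R)` is absorbed. -/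

namespace Quasicrystal

/-! ### Smooth cutoffs and absolutely convergent Fourier series on the circle -/

lemma exists_schwartz_bump (V : Type*) [NormedAddCommGroup V] [InnerProductSpace ℝ V]
    [FiniteDimensional ℝ V] {r : ℝ} (hr : 0 < r) :
    ∃ f : 𝓢(V, ℂ), HasCompactSupport f ∧ f 0 = 1 ∧ ∀ x, r ≤ ‖x‖ → f x = 0 := by
  let g : ContDiffBump (0 : V) := ⟨r / 2, r, half_pos hr, half_lt_self hr⟩
  have hc : HasCompactSupport (fun x => (g x : ℂ)) :=
    g.hasCompactSupport.comp_left (g := Complex.ofReal) Complex.ofReal_zero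
  refine ⟨hc.toSchwartzMap (Complex.ofRealCLM.contDiff.comp g.contDiff), hc, ?_, fun x hx => ?_⟩
  · change (g 0 : ℂ) = 1
    simp [g.one_of_mem_closedBall (Metric.mem_closedBall_self g.rIn_pos.le)]
  · change (g x : ℂ) = 0
    simp [g.zero_of_le_dist (x := x) (by simpa using hx)]

lemma norm_exp_two_pi_I_sub_one_le (t : ℝ) :
    ‖Complex.exp (2 * Real.pi * Complex.I * t) - 1‖ ≤ 2 * Real.pi * |t| := by
  have h := Real.norm_exp_I_mul_ofReal_sub_one_le (x := 2 * Real.pi * t)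
  rw [show (2 * Real.pi * Complex.I * t : ℂ) = Complex.I * ((2 * Real.pi * t : ℝ) : ℂ) by
    push_cast; ring]
  refine h.trans_eq ?_
  rw [Real.norm_eq_abs, abs_mul, abs_of_pos Real.two_pi_pos]

/-- An absolutely convergent Fourier series localized near the point `1` of the unit circle. -/
lemma exists_circle_cutoff {δ : ℝ} (hδ : 0 < δ) :
    ∃ b : ℤ → ℂ, Summable (fun k => ‖b k‖) ∧ ∑' k, b k = 1 ∧
      ∀ z : ℂ, ‖z‖ = 1 → δ ≤ ‖z - 1‖ → ∑' k, b k * z ^ k = 0 := by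
  -- Radius at most `1` leaves only `n = 0` in the periodization at `x = 0`; radius at most `δ /
  -- (2π)` makes the periodization vanish wherever the point of the circle is `δ`-far from `1`.
  obtain ⟨f, -, hf0, hf⟩ := exists_schwartz_bump ℝ
    (r := min 1 (δ / (2 * Real.pi))) (by positivity)
  -- Poisson summation: the periodized bump is the Fourier series with coefficients `𝓕 f n`.
  have key (x : ℝ) : ∑' n : ℤ, f (x + n) =
      ∑' n : ℤ, 𝓕 f n * Complex.exp (2 * Real.pi * Complex.I * x) ^ n := by
    rw [SchwartzMap.tsum_eq_tsum_fourier]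
    refine tsum_congr fun n => ?_
    rw [fourier_coe_apply, ← Complex.exp_int_mul]
    congr 2
    push_cast
    ring
  refine ⟨fun n => 𝓕 f n, ?_, ?_, fun z hz hzδ => ?_⟩
  · have h := ((𝓕 f).isBigO_cocompact_rpow (-2)).comp_tendsto Int.tendsto_coe_cofinite
    exact (summable_of_isBigO (Real.summable_abs_int_rpow one_lt_two) h).norm
  · have h := key 0
    simp only [Complex.ofReal_zero, mul_zero, Complex.exp_zero, one_zpow, mul_one, zero_add] at h
    rw [← h, tsum_eq_single 0, Int.cast_zero, hf0]
    intro n hn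
    refine hf _ ((min_le_left _ _).trans ?_)
    rw [Real.norm_eq_abs]
    exact_mod_cast Int.one_le_abs hn
  · obtain ⟨θ, hθ⟩ := (Complex.norm_eq_one_iff z).mp hz
    have hx : z = Complex.exp (2 * Real.pi * Complex.I * ((θ / (2 * Real.pi) : ℝ) : ℂ)) := by
      rw [← hθ]
      congr 1
      push_cast
      have : (Real.pi : ℂ) ≠ 0 := by exact_mod_cast Real.pi_ne_zero
      field_simp
    set x : ℝ := θ / (2 * Real.pi)
    rw [hx, ← key, ← tsum_zero (β := ℤ) (α := ℂ)]
    refine tsum_congr fun n => hf _ ((min_le_right _ _).trans ?_)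
    rw [div_le_iff₀ Real.two_pi_pos, mul_comm]
    rw [Real.norm_eq_abs]
    refine (hzδ.trans_eq ?_).trans (norm_exp_two_pi_I_sub_one_le (x + n))
    congr 2
    rw [hx, Complex.ofReal_add, Complex.ofReal_intCast, mul_add, Complex.exp_add,
      show (2 * Real.pi * Complex.I * n : ℂ) = n * (2 * Real.pi * Complex.I) by ring,
      Complex.exp_int_mul_two_pi_mul_I n, mul_one]

/-! ### Wiener's lemma in a commutative Banach algebra -/

section Wiener

variable {A : Type*} [NormedCommRing A] [NormedAlgebra ℂ A] [CompleteSpace A]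
  {Γ : Type*} [AddCommGroup Γ]

/-- The values at `γ` and `γ⁻¹` have modulus at most `1` and product `1`. -/
lemma norm_apply_eq_one_of_contractive {τ : Multiplicative Γ →* A} (hτ : ∀ γ, ‖τ γ‖ ≤ 1)
    (φ : A →ₐ[ℂ] ℂ) (γ : Multiplicative Γ) : ‖φ (τ γ)‖ = 1 := by
  have h1 : ‖(1 : A)‖ ≤ 1 := by simpa using hτ 1
  have hle (γ) : ‖φ (τ γ)‖ ≤ 1 :=
    (AlgHom.norm_apply_le_self_mul_norm_one φ _).trans
      (mul_le_one₀ (hτ γ) (norm_nonneg _) h1)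
  have hmul : ‖φ (τ γ)‖ * ‖φ (τ γ⁻¹)‖ = 1 := by
    rw [← norm_mul, ← map_mul, ← map_mul, mul_inv_cancel, map_one, map_one, norm_one]
  nlinarith [hle γ, hle γ⁻¹, norm_nonneg (φ (τ γ)), norm_nonneg (φ (τ γ⁻¹))]

lemma algHom_tsum {ι : Type*} (φ : A →ₐ[ℂ] ℂ) {c : ι → ℂ} {a : ι → A}
    (h : Summable fun i => c i • a i) : φ (∑' i, c i • a i) = ∑' i, c i * φ (a i) := by
  have := φ.toContinuousLinearMap.map_tsum h
  simpa using this

lemma summable_smul_of_contractive {ι : Type*} {c : ι → ℂ} (hc : Summable fun i => ‖c i‖)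
    {a : ι → A} (ha : ∀ i, ‖a i‖ ≤ 1) : Summable fun i => c i • a i := by
  refine .of_norm_bounded hc fun i => ?_
  rw [norm_smul]
  exact mul_le_of_le_one_right (norm_nonneg _) (ha i)

/-- A local form of Wiener's lemma. -/
theorem isUnit_tsum_smul_of_le_norm {τ : Multiplicative Γ →* A} (hτ : ∀ γ, ‖τ γ‖ ≤ 1)
    {ι : Type*} (ev : ι → A →ₐ[ℂ] ℂ) (hev : ∀ a, (∀ i, ev i a = 0) → a = 0)
    {ν : Multiplicative Γ → ℂ} (hν : Summable fun γ => ‖ν γ‖) {ε : ℝ} (hε : 0 < ε)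
    (hle : ∀ i, ε ≤ ‖ev i (∑' γ, ν γ • τ γ)‖) : IsUnit (∑' γ, ν γ • τ γ) := by
  -- A non-invertible element is killed by some character `φ`. The plan is to show that `φ` stays
  -- away from all `ev i`, then to build an element that every `ev i` kills but `φ` does not.
  by_contra hunit
  obtain ⟨ψ, hψ⟩ := WeakDual.CharacterSpace.exists_apply_eq_zero hunit
  set φ : A →ₐ[ℂ] ℂ := WeakDual.CharacterSpace.toAlgHom ψ
  have hφ0 : φ (∑' γ, ν γ • τ γ) = 0 := hψ
  have hsum := summable_smul_of_contractive hν hτ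
  have hφ1 := norm_apply_eq_one_of_contractive hτ φ
  have hev1 (i) := norm_apply_eq_one_of_contractive hτ (ev i)
  set C := ∑' γ, ‖ν γ‖
  have hC : 0 ≤ C := tsum_nonneg fun _ => norm_nonneg _
  have hdiff (i) : ε ≤ ∑' γ, ‖ν γ‖ * ‖ev i (τ γ) - φ (τ γ)‖ := by
    have hs : ∀ χ : A →ₐ[ℂ] ℂ, Summable fun γ => ν γ * χ (τ γ) := fun χ => by
      refine .of_norm (hν.congr fun γ => ?_)
      rw [norm_mul, norm_apply_eq_one_of_contractive hτ χ, mul_one]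
    calc ε ≤ ‖ev i (∑' γ, ν γ • τ γ) - φ (∑' γ, ν γ • τ γ)‖ := by
          rw [hφ0, sub_zero]; exact hle i
      _ = ‖∑' γ, ν γ * (ev i (τ γ) - φ (τ γ))‖ := by
          rw [algHom_tsum _ hsum, algHom_tsum _ hsum, ← (hs _).tsum_sub (hs _)]
          simp only [mul_sub]
      _ ≤ ∑' γ, ‖ν γ‖ * ‖ev i (τ γ) - φ (τ γ)‖ := by
          simp only [← norm_mul]
          refine norm_tsum_le_tsum_norm ?_
          refine .of_nonneg_of_le (fun _ => norm_nonneg _) (fun γ => ?_) (hν.mul_right 2)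
          rw [norm_mul]
          gcongr
          refine (norm_sub_le _ _).trans ?_
          rw [hφ1, hev1]; norm_num
  -- Each difference of characters is at most `2`, so the tail off `S` contributes less than `ε /
  -- 2`. With `δ` below, differences under `δ` on `S` would contribute at most `C * δ < ε / 2`,
  -- contradicting `hdiff`.
  obtain ⟨S, hS⟩ : ∃ S : Finset (Multiplicative Γ), ∑' γ : {γ // γ ∉ S}, ‖ν γ‖ < ε / 4 :=
    ((tendsto_order.1 (tendsto_tsum_compl_atTop_zero fun γ => ‖ν γ‖)).2 _
      (by positivity)).exists
  set δ := ε / (2 * (C + 1)) with hδ_def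
  have hδ : 0 < δ := by positivity
  have hfar (i) : ∃ γ ∈ S, δ ≤ ‖ev i (τ γ) - φ (τ γ)‖ := by
    by_contra! hcon
    have hle2 (γ) : ‖ev i (τ γ) - φ (τ γ)‖ ≤ 2 := by
      refine (norm_sub_le _ _).trans ?_
      rw [hφ1, hev1]; norm_num
    have hs : Summable fun γ => ‖ν γ‖ * ‖ev i (τ γ) - φ (τ γ)‖ :=
      .of_nonneg_of_le (fun _ => by positivity)
        (fun γ => mul_le_mul_of_nonneg_left (hle2 γ) (norm_nonneg _)) (hν.mul_right 2)
    have h1 : ∑ γ ∈ S, ‖ν γ‖ * ‖ev i (τ γ) - φ (τ γ)‖ ≤ C * δ := by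
      calc _ ≤ ∑ γ ∈ S, ‖ν γ‖ * δ := Finset.sum_le_sum fun γ hγ =>
            mul_le_mul_of_nonneg_left (hcon γ hγ).le (norm_nonneg _)
        _ = (∑ γ ∈ S, ‖ν γ‖) * δ := by rw [Finset.sum_mul]
        _ ≤ C * δ := by
            gcongr
            exact hν.sum_le_tsum _ fun _ _ => norm_nonneg _
    have h2 : ∑' γ : {γ // γ ∉ S}, ‖ν γ‖ * ‖ev i (τ γ) - φ (τ γ)‖ ≤
        (∑' γ : {γ // γ ∉ S}, ‖ν γ‖) * 2 := by
      rw [← tsum_mul_right]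
      exact (hs.subtype _).tsum_le_tsum
        (fun γ => mul_le_mul_of_nonneg_left (hle2 γ) (norm_nonneg _))
        ((hν.subtype _).mul_right 2)
    have h3 := hdiff i
    rw [← hs.sum_add_tsum_subtype_compl S] at h3
    have h4 : C * δ < ε / 2 := by
      rw [hδ_def, mul_div_assoc', div_lt_div_iff₀ (by positivity) two_pos]
      nlinarith
    linarith
  obtain ⟨b, hb, hb1, hb0⟩ := exists_circle_cutoff hδ
  have hnorm (γ : Multiplicative Γ) (k : ℤ) : ‖((φ (τ γ))⁻¹ ^ k) • τ (γ ^ k)‖ ≤ 1 := by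
    rw [norm_smul, norm_zpow, norm_inv, hφ1, inv_one, one_zpow, one_mul]
    exact hτ _
  have hzpow (χ : A →ₐ[ℂ] ℂ) (γ : Multiplicative Γ) (k : ℤ) : χ (τ (γ ^ k)) = χ (τ γ) ^ k := by
    have : ∀ χ : A →ₐ[ℂ] ℂ, ∃ f : Multiplicative Γ →* ℂˣ, ∀ γ, (f γ : ℂ) = χ (τ γ) := fun χ =>
      ⟨((χ : A →* ℂ).comp τ).toHomUnits, fun γ => rfl⟩
    obtain ⟨f, hf⟩ := this χ
    rw [← hf, ← hf, map_zpow, Units.val_zpow_eq_zpow_val]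
  -- The circle cutoff applied to `(φ (τ γ))⁻¹ • τ γ`: it takes the value `1` at `φ`, and `0` at
  -- each `ev i` that differs from `φ` by at least `δ` at `τ γ`.
  let h (γ : Multiplicative Γ) : A := ∑' k, b k • ((φ (τ γ))⁻¹ ^ k • τ (γ ^ k))
  have happly (χ : A →ₐ[ℂ] ℂ) (γ) : χ (h γ) = ∑' k, b k * ((φ (τ γ))⁻¹ * χ (τ γ)) ^ k := by
    simp only [h]
    rw [algHom_tsum χ (summable_smul_of_contractive hb (hnorm γ))]
    refine tsum_congr fun k => ?_
    rw [map_smul, hzpow, smul_eq_mul, mul_zpow]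
  have hφne (γ) : φ (τ γ) ≠ 0 := by
    rw [← norm_pos_iff, hφ1]; exact one_pos
  have hH : ∏ γ ∈ S, h γ = 0 := by
    refine hev _ fun i => ?_
    obtain ⟨γ, hγ, hγδ⟩ := hfar i
    rw [map_prod]
    refine Finset.prod_eq_zero hγ ?_
    rw [happly]
    refine hb0 _ ?_ ?_
    · rw [norm_mul, norm_inv, hφ1, hev1, inv_one, one_mul]
    · rwa [show (φ (τ γ))⁻¹ * ev i (τ γ) - 1 = (φ (τ γ))⁻¹ * (ev i (τ γ) - φ (τ γ)) by
        rw [mul_sub, inv_mul_cancel₀ (hφne γ)], norm_mul, norm_inv, hφ1, inv_one, one_mul]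
  have hone : φ (∏ γ ∈ S, h γ) = 1 := by
    rw [map_prod]
    refine Finset.prod_eq_one fun γ _ => ?_
    rw [happly, inv_mul_cancel₀ (hφne γ)]
    simpa using hb1
  rw [hH, map_zero] at hone
  exact zero_ne_one hone

end Wiener

/-! ### Exponentials and translation bounded measures -/

open MeasureTheory

variable {d : ℕ}

/-- The exponential `x ↦ exp(2πi⟨x, u⟩)` of frequency `u`. -/
@[irreducible] noncomputable def wave (u x : E d) : ℂ :=
  Complex.exp (2 * Real.pi * Complex.I * (⟪x, u⟫ : ℝ))

lemma wave_add (u x y : E d) : wave u (x + y) = wave u x * wave u y := by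
  simp [wave, inner_add_left, mul_add, Complex.exp_add]

@[simp] lemma wave_zero (u : E d) : wave u 0 = 1 := by simp [wave]

@[simp] lemma norm_wave (u x : E d) : ‖wave u x‖ = 1 := by
  rw [wave, show (2 * Real.pi * Complex.I * (⟪x, u⟫ : ℝ) : ℂ) =
    ((2 * Real.pi * ⟪x, u⟫ : ℝ) : ℂ) * Complex.I by push_cast; ring]
  exact Complex.norm_exp_ofReal_mul_I _

lemma wave_comm (u x : E d) : wave u x = wave x u := by
  rw [wave, wave, real_inner_comm]

lemma contDiff_wave (u : E d) {n : WithTop ℕ∞} : ContDiff ℝ n (wave u) := by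
  unfold wave
  exact (contDiff_const.mul (Complex.ofRealCLM.contDiff.comp
    (contDiff_id.inner ℝ contDiff_const))).cexp

namespace AtomicMeasure

lemma sum_enorm_coeff_ball_le (ν : AtomicMeasure d) (F : Finset (E d)) (z : E d) :
    ∑ x ∈ F, (Metric.ball z 1).indicator (fun x => ‖ν.coeff x‖ₑ) x ≤
      ν.variation (Metric.ball z 1) := by
  classical
  rw [variation, Measure.sum_apply _ Metric.isOpen_ball.measurableSet]
  calc ∑ x ∈ F, (Metric.ball z 1).indicator (fun x => ‖ν.coeff x‖ₑ) x
      = ∑ x ∈ F with x ∈ ν.carrier, (Metric.ball z 1).indicator (fun x => ‖ν.coeff x‖ₑ) x := by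
        refine (Finset.sum_filter_of_ne fun x _ hx => ?_).symm
        by_contra hcar
        simp [Set.indicator, ν.coeff_eq_zero x hcar] at hx
    _ = ∑ x ∈ F.subtype (· ∈ ν.carrier),
          (Metric.ball z 1).indicator (fun x => ‖ν.coeff x‖ₑ) (x : E d) :=
        (Finset.sum_subtype_eq_sum_filter _).symm
    _ ≤ ∑' x : ν.carrier, (Metric.ball z 1).indicator (fun x => ‖ν.coeff x‖ₑ) (x : E d) :=
        ENNReal.sum_le_tsum _
    _ = _ := by
        refine tsum_congr fun x => ?_
        rw [Measure.smul_apply, Measure.dirac_apply' _ Metric.isOpen_ball.measurableSet]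
        by_cases hx : (x : E d) ∈ Metric.ball z 1 <;> simp [hx]

lemma TranslationBounded.exists_sum_norm_coeff_le {ν : AtomicMeasure d}
    (hν : ν.TranslationBounded) : ∃ C : ℝ, 0 ≤ C ∧ ∀ (F : Finset (E d)) (z : E d),
      ∑ x ∈ F, (Metric.ball z 1).indicator (fun x => ‖ν.coeff x‖) x ≤ C := by
  obtain ⟨C, hC⟩ := hν
  refine ⟨C, C.2, fun F z => ?_⟩
  have h := (ν.sum_enorm_coeff_ball_le F z).trans (hC z)
  have h2 : ∑ x ∈ F, (Metric.ball z 1).indicator (fun x => ‖ν.coeff x‖ₑ) x =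
      ENNReal.ofReal (∑ x ∈ F, (Metric.ball z 1).indicator (fun x => ‖ν.coeff x‖) x) := by
    rw [ENNReal.ofReal_sum_of_nonneg fun x _ => Set.indicator_nonneg (fun _ _ => norm_nonneg _) _]
    refine Finset.sum_congr rfl fun x _ => ?_
    by_cases hx : x ∈ Metric.ball z 1 <;> simp [hx]
  rw [h2, ← ENNReal.ofReal_coe_nnreal] at h
  exact (ENNReal.ofReal_le_ofReal_iff C.2).mp h

/-- A translation bounded measure integrates all translates of `(1 + ‖x‖) ^ (-(d + 1))`, with one
common bound. -/
lemma TranslationBounded.exists_tsum_decay_le {ν : AtomicMeasure d} (hν : ν.TranslationBounded) :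
    ∃ C : ℝ, 0 ≤ C ∧ ∀ x : E d,
      Summable (fun γ => ‖ν.coeff γ‖ * (1 + ‖x + γ‖) ^ (-(d + 1 : ℝ))) ∧
      ∑' γ, ‖ν.coeff γ‖ * (1 + ‖x + γ‖) ^ (-(d + 1 : ℝ)) ≤ C := by
  obtain ⟨C, hC0, hC⟩ := hν.exists_sum_norm_coeff_le
  set r : ℝ := d + 1 with hr
  have hr0 : 0 ≤ r := by positivity
  set k : E d → ℝ := fun y => (1 + ‖y‖) ^ (-r) with hk
  have hk0 (y) : 0 ≤ k y := by positivity
  have hint : Integrable k := integrable_one_add_norm (by simp [hr])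
  have hcomp (y z : E d) (h : ‖z - y‖ ≤ 1) : k y ≤ 2 ^ r * k z := by
    simp only [hk]
    rw [Real.rpow_neg (by positivity), Real.rpow_neg (by positivity), ← div_eq_mul_inv,
      inv_eq_one_div, div_le_div_iff₀ (by positivity) (by positivity), one_mul,
      ← Real.mul_rpow (by positivity) (by positivity)]
    refine Real.rpow_le_rpow (by positivity) ?_ hr0
    have : ‖z‖ ≤ ‖z - y‖ + ‖y‖ := by simpa using norm_add_le (z - y) y
    linarith [norm_nonneg y]
  set v : ℝ := volume.real (Metric.ball (0 : E d) 1)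
  have hv (γ : E d) : volume.real (Metric.ball γ 1) = v := by
    simp only [v, Measure.real]
    rw [Measure.addHaar_ball_center]
  have hv0 : 0 < v := ENNReal.toReal_pos (Metric.measure_ball_pos _ _ one_pos).ne'
    measure_ball_lt_top.ne
  -- The kernel varies by a factor of at most `2 ^ r` on unit balls, so its value at a point is
  -- controlled by its mean over the ball. Interchanging sum and integral then leaves `∑ ‖ν.coeff
  -- γ‖` over `γ` in a unit ball, which is at most `C`.
  have hball (x γ : E d) : k (x + γ) * v ≤ 2 ^ r * ∫ z in Metric.ball γ 1, k (x + z) := by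
    have h1 : ∫ z in Metric.ball γ 1, k (x + γ) = v * k (x + γ) := by
      rw [setIntegral_const, hv, smul_eq_mul]
    rw [mul_comm, ← h1, ← integral_const_mul]
    refine setIntegral_mono_on (integrableOn_const measure_ball_lt_top.ne)
      ((hint.comp_add_left x).integrableOn.const_mul _) Metric.isOpen_ball.measurableSet
      fun z hz => hcomp _ _ ?_
    rw [add_sub_add_left_eq_sub, ← dist_eq_norm]
    exact (Metric.mem_ball.mp hz).le
  have hfin (x : E d) (F : Finset (E d)) :
      ∑ γ ∈ F, ‖ν.coeff γ‖ * k (x + γ) ≤ 2 ^ r * C * (∫ z, k z) / v := by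
    rw [le_div_iff₀ hv0]
    calc (∑ γ ∈ F, ‖ν.coeff γ‖ * k (x + γ)) * v
        = ∑ γ ∈ F, ‖ν.coeff γ‖ * (k (x + γ) * v) := by
          rw [Finset.sum_mul]; simp only [mul_assoc]
      _ ≤ ∑ γ ∈ F, ‖ν.coeff γ‖ * (2 ^ r * ∫ z in Metric.ball γ 1, k (x + z)) := by
          exact Finset.sum_le_sum fun γ _ => mul_le_mul_of_nonneg_left (hball x γ) (norm_nonneg _)
      _ = 2 ^ r * ∫ z, ∑ γ ∈ F,
            ‖ν.coeff γ‖ * (Metric.ball γ 1).indicator (fun z => k (x + z)) z := by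
          rw [integral_finsetSum, Finset.mul_sum]
          · refine Finset.sum_congr rfl fun γ _ => ?_
            rw [integral_const_mul, integral_indicator Metric.isOpen_ball.measurableSet]
            ring
          · exact fun γ _ => ((hint.comp_add_left x).indicator
              Metric.isOpen_ball.measurableSet).const_mul _
      _ ≤ 2 ^ r * ∫ z, C * k (x + z) := by
          refine mul_le_mul_of_nonneg_left ?_ (by positivity)
          refine integral_mono (integrable_finsetSum _ fun γ _ => ((hint.comp_add_left x).indicator
              Metric.isOpen_ball.measurableSet).const_mul _)
              ((hint.comp_add_left x).const_mul _) fun z => ?_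
          refine le_trans (le_of_eq ?_) (mul_le_mul_of_nonneg_right (hC F z) (hk0 _))
          rw [Finset.sum_mul]
          refine Finset.sum_congr rfl fun γ _ => ?_
          by_cases h : dist γ z < 1
          · simp [Set.indicator, h, dist_comm z γ]
          · simp [Set.indicator, h, dist_comm z γ]
      _ = 2 ^ r * C * ∫ z, k z := by
          rw [integral_const_mul, integral_add_left_eq_self, mul_assoc]
  have hI : 0 ≤ ∫ z, k z := integral_nonneg hk0
  exact ⟨_, by positivity, fun x =>
    ⟨summable_of_sum_le (fun γ => mul_nonneg (norm_nonneg _) (hk0 _)) (hfin x),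
      Real.tsum_le_of_sum_le (fun γ => mul_nonneg (norm_nonneg _) (hk0 _)) (hfin x)⟩⟩

end AtomicMeasure

/-! ### Localization of exponential sums through the dual measure -/

/-- The masses of `μ` at isolated points as Fourier coefficients with respect to the dual
measure. -/
lemma exists_schwartz_hasSum {μ μhat : AtomicMeasure d} {T : 𝓢'(E d, ℂ)}
    (hT : μ.IsDistribution T) (hThat : μhat.IsDistribution (FourierTransform.fourier T))
    {U : Set (E d)} {ε : ℝ} (hε : 0 < ε)
    (hsep : ∀ x ∈ U, ∀ y ∈ μ.carrier \ {x}, ε ≤ dist x y) :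
    ∃ κ : 𝓢(E d, ℂ), ∀ u ∈ U, ∀ x,
      HasSum (fun γ => μhat.coeff γ * κ (x + γ) * wave u (x + γ)) (μ.coeff u * wave u x) := by
  obtain ⟨g, hgc, hg0, hg⟩ := exists_schwartz_bump (E d) hε
  refine ⟨𝓕⁻ g, fun u hu x => ?_⟩
  have hc : HasCompactSupport (fun y => g (y - u) * wave x y) := by
    refine HasCompactSupport.mul_right (f := fun y => g (y - u)) ?_
    exact hgc.comp_homeomorph (Homeomorph.subRight u)
  -- The bump sees no point of the carrier other than `u`, so `T ψ` is the mass at `u` times a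
  -- phase. The modulation by `wave x` becomes the shift by `x` in `𝓕⁻ ψ`.
  let ψ : 𝓢(E d, ℂ) := hc.toSchwartzMap
    (((g.smooth _).comp (contDiff_id.sub contDiff_const)).mul (contDiff_wave x))
  have hψ (y) : ψ y = g (y - u) * wave x y := rfl
  have hinv (γ) : (𝓕⁻ ψ) γ = (𝓕⁻ g) (x + γ) * wave u (x + γ) := by
    rw [SchwartzMap.fourierInv_coe, SchwartzMap.fourierInv_coe, Real.fourierInv_eq',
      Real.fourierInv_eq', ← integral_add_right_eq_self _ u, ← integral_mul_const]
    congr 1 with y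
    have key : Complex.exp ((2 * Real.pi * ⟪y + u, γ⟫ : ℝ) * Complex.I) * wave x (y + u) =
        Complex.exp ((2 * Real.pi * ⟪y, x + γ⟫ : ℝ) * Complex.I) * wave (x + γ) u := by
      simp only [wave, ← Complex.exp_add, inner_add_left, inner_add_right]
      congr 1
      push_cast
      ring
    rw [hψ, add_sub_cancel_right, wave_comm u, smul_eq_mul, smul_eq_mul]
    linear_combination g y * key
  have h1 : T ψ = μ.coeff u * wave u x := by
    refine (hT ψ).unique ?_
    have := hasSum_single (f := fun y => μ.coeff y * ψ y) u ?_
    · simpa [hψ, hg0, wave_comm u x] using this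
    · intro y hy
      by_cases hyc : y ∈ μ.carrier
      · simp only [hψ]
        rw [hg, zero_mul, mul_zero]
        rw [← dist_eq_norm, dist_comm]
        exact hsep u hu y ⟨hyc, hy⟩
      · simp only [μ.coeff_eq_zero y hyc, zero_mul]
  have h2 := hThat (𝓕⁻ ψ)
  rw [TemperedDistribution.fourier_apply, FourierTransform.fourier_fourierInv_eq, h1] at h2
  simpa only [hinv, mul_assoc] using h2

/-- The power `-(d + 1)` makes sums against a translation bounded measure converge; the extra factor
`1 / (1 + ‖y‖)` yields the gain `1 / (1 + R)` outside the ball of radius `R`. -/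
lemma exists_schwartz_decay (κ : 𝓢(E d, ℂ)) : ∃ K : ℝ, 0 ≤ K ∧ ∀ y,
    ‖κ y‖ ≤ K * (1 + ‖y‖) ^ (-(d + 1 : ℝ)) / (1 + ‖y‖) := by
  have h (y : E d) := SchwartzMap.one_add_le_sup_seminorm_apply (𝕜 := ℝ) (m := (d + 2, 0))
    (k := d + 2) (n := 0) le_rfl le_rfl κ y
  refine ⟨_, (by positivity : (0:ℝ) ≤ _).trans (h 0), fun y => ?_⟩
  have hy : 0 < 1 + ‖y‖ := by positivity
  rw [le_div_iff₀ hy, show (-(d + 1 : ℝ)) = -((d + 1 : ℕ) : ℝ) by push_cast; rfl,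
    Real.rpow_neg hy.le, Real.rpow_natCast, ← div_eq_mul_inv, le_div_iff₀ (by positivity)]
  refine le_trans (le_of_eq ?_) (h y)
  rw [norm_iteratedFDeriv_zero]
  ring

/-- Multiplying the coefficients of an exponential sum by the masses of `μ` is bounded on the
whole space by the values on a ball, up to a small multiple of the values on the whole space. -/
lemma exists_norm_sum_coeff_le {μ μhat : AtomicMeasure d}
    (hμhat : μhat.TranslationBounded)
    {U : Set (E d)} {κ : 𝓢(E d, ℂ)} (hκ : ∀ u ∈ U, ∀ x,
      HasSum (fun γ => μhat.coeff γ * κ (x + γ) * wave u (x + γ)) (μ.coeff u * wave u x)) :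
    ∃ A : ℝ, 0 ≤ A ∧ ∀ (R M N : ℝ) (s : Finset (E d)) (c : E d → ℂ), 0 ≤ R → (∀ u ∈ s, u ∈ U) →
      (∀ y, ‖y‖ ≤ R → ‖∑ u ∈ s, c u * wave u y‖ ≤ M) → (∀ y, ‖∑ u ∈ s, c u * wave u y‖ ≤ N) →
      ∀ x, ‖∑ u ∈ s, c u * (μ.coeff u * wave u x)‖ ≤ A * (M + N / (1 + R)) := by
  obtain ⟨C, hC0, hC⟩ := hμhat.exists_tsum_decay_le
  obtain ⟨K, hK0, hK⟩ := exists_schwartz_decay κ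
  refine ⟨C * K, by positivity, fun R M N s c hR hs hM hN x => ?_⟩
  have hM0 : 0 ≤ M := (norm_nonneg _).trans (hM 0 (by simpa))
  have hN0 : 0 ≤ N := (norm_nonneg _).trans (hN 0)
  obtain ⟨hsum, hle⟩ := hC x
  have h1 : HasSum (fun γ => μhat.coeff γ * κ (x + γ) * ∑ u ∈ s, c u * wave u (x + γ))
      (∑ u ∈ s, c u * (μ.coeff u * wave u x)) := by
    have := hasSum_sum fun u hu => (hκ u (hs u hu) x).mul_left (c u)
    refine this.congr_fun fun γ => ?_
    rw [Finset.mul_sum]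
    exact Finset.sum_congr rfl fun u _ => by ring
  have hbound (y : E d) : ‖κ y * ∑ u ∈ s, c u * wave u y‖ ≤
      K * (1 + ‖y‖) ^ (-(d + 1 : ℝ)) * (M + N / (1 + R)) := by
    have hy : 0 ≤ K * (1 + ‖y‖) ^ (-(d + 1 : ℝ)) := by positivity
    rw [norm_mul]
    by_cases hyR : ‖y‖ ≤ R
    · have h3 : ‖κ y‖ ≤ K * (1 + ‖y‖) ^ (-(d + 1 : ℝ)) :=
        (hK y).trans (div_le_self hy (by linarith [norm_nonneg y]))
      refine mul_le_mul h3 ((hM y hyR).trans ?_) (norm_nonneg _) hy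
      linarith [show 0 ≤ N / (1 + R) by positivity]
    · push Not at hyR
      have h3 : ‖κ y‖ ≤ K * (1 + ‖y‖) ^ (-(d + 1 : ℝ)) / (1 + R) :=
        (hK y).trans (div_le_div_of_nonneg_left hy (by linarith) (by linarith))
      calc _ ≤ K * (1 + ‖y‖) ^ (-(d + 1 : ℝ)) / (1 + R) * N :=
            mul_le_mul h3 (hN y) (norm_nonneg _) (by positivity)
        _ = K * (1 + ‖y‖) ^ (-(d + 1 : ℝ)) * (N / (1 + R)) := by ring
        _ ≤ _ := mul_le_mul_of_nonneg_left (by linarith) hy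
  have hMN : 0 ≤ M + N / (1 + R) := by positivity
  rw [← h1.tsum_eq]
  calc _ ≤ ∑' γ, ‖μhat.coeff γ‖ * (1 + ‖x + γ‖) ^ (-(d + 1 : ℝ)) * (K * (M + N / (1 + R))) := by
        refine tsum_of_norm_bounded (hsum.mul_right _).hasSum fun γ => ?_
        rw [mul_assoc, norm_mul]
        refine (mul_le_mul_of_nonneg_left (hbound _) (norm_nonneg _)).trans_eq ?_
        ring
    _ = (∑' γ, ‖μhat.coeff γ‖ * (1 + ‖x + γ‖) ^ (-(d + 1 : ℝ))) * (K * (M + N / (1 + R))) :=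
        tsum_mul_right
    _ ≤ C * (K * (M + N / (1 + R))) := by gcongr
    _ = _ := by ring

lemma summable_norm_coeff_mul_schwartz {μhat : AtomicMeasure d} (hμhat : μhat.TranslationBounded)
    (κ : 𝓢(E d, ℂ)) : Summable fun γ => ‖μhat.coeff γ * κ γ‖ := by
  obtain ⟨C, -, hC⟩ := hμhat.exists_tsum_decay_le
  obtain ⟨K, hK0, hK⟩ := exists_schwartz_decay κ
  have h := (hC 0).1.mul_right K
  simp only [zero_add] at h
  refine .of_nonneg_of_le (fun _ => norm_nonneg _) (fun γ => ?_) h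
  rw [norm_mul, mul_assoc, mul_comm _ K]
  refine mul_le_mul_of_nonneg_left ((hK γ).trans (div_le_self (by positivity) ?_)) (norm_nonneg _)
  linarith [norm_nonneg γ]

/-! ### Invertibility of diagonal operators on a closed span -/

open scoped BoundedContinuousFunction

section Diagonal

/-- Vectors `e i` with dense span, together with a functional that takes the value `1` at each. -/
structure NormalizedSystem (ι V : Type*) [NormedAddCommGroup V] [NormedSpace ℂ V] where
  e : ι → V
  functional : V →L[ℂ] ℂ
  functional_e : ∀ i, functional (e i) = 1
  dense : (Submodule.span ℂ (Set.range e)).topologicalClosure = ⊤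

variable {ι V : Type*} [NormedAddCommGroup V] [NormedSpace ℂ V]

namespace NormalizedSystem

variable (D : NormalizedSystem ι V)

lemma continuousLinearMap_ext {S T : V →L[ℂ] V} (h : ∀ i, S (D.e i) = T (D.e i)) : S = T :=
  ContinuousLinearMap.ext_on
    (Submodule.dense_iff_topologicalClosure_eq_top.mpr D.dense) (by rintro _ ⟨i, rfl⟩; exact h i)

/-- The operators of which every `e i` is an eigenvector. -/
noncomputable def diagonal : Subalgebra ℂ (V →L[ℂ] V) where
  -- As `D.functional` is `1` at `D.e i`, this is the only possible eigenvalue. The condition is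
  -- thus an equation, closed in `T`.
  carrier := {T | ∀ i, T (D.e i) = D.functional (T (D.e i)) • D.e i}
  mul_mem' {S T} hS hT i := by
    rw [mul_apply_eq_comp, hT i, map_smul, hS i]
    simp [smul_smul, D.functional_e]
  add_mem' {S T} hS hT i := by
    rw [add_apply, hT i, hS i]
    simp [add_smul, D.functional_e]
  algebraMap_mem' r i := by
    simp [Algebra.algebraMap_eq_smul_one, D.functional_e]

/-- The eigenvalue of a diagonal operator at `e i`. -/
noncomputable def eigenvalue (i : ι) : D.diagonal →ₐ[ℂ] ℂ where
  toFun T := D.functional (T.1 (D.e i))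
  map_one' := by simp [D.functional_e]
  map_mul' S T := by
    change D.functional (S.1 (T.1 (D.e i))) = _
    rw [T.2 i, map_smul, map_smul, map_smul, D.functional_e, smul_eq_mul, smul_eq_mul, mul_one,
      mul_comm]
  map_zero' := by simp
  map_add' S T := by simp
  commutes' r := by simp [Algebra.algebraMap_eq_smul_one, D.functional_e]

lemma diagonal_apply (T : D.diagonal) (i : ι) : T.1 (D.e i) = D.eigenvalue i T • D.e i := T.2 i

/-- Density of the span of the `D.e i` is what is needed here. Two consequences are used: the
algebra is commutative, and the eigenvalue characters separate its elements, as Wiener's lemma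
requires. -/
lemma diagonal_ext {S T : D.diagonal} (h : ∀ i, D.eigenvalue i S = D.eigenvalue i T) : S = T :=
  Subtype.ext (D.continuousLinearMap_ext fun i => by
    rw [diagonal_apply, diagonal_apply, h])

noncomputable instance : NormedCommRing D.diagonal :=
  { (inferInstance : NormedRing D.diagonal) with
    mul_comm := fun S T => D.diagonal_ext fun i => by rw [map_mul, map_mul, mul_comm] }

instance [CompleteSpace V] : CompleteSpace D.diagonal := by
  suffices h : IsClosed (D.diagonal : Set (V →L[ℂ] V)) from h.completeSpace_coe
  change IsClosed {T : V →L[ℂ] V | ∀ i, T (D.e i) = D.functional (T (D.e i)) • D.e i}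
  simp only [Set.ofPred_forall]
  refine isClosed_iInter fun i => ?_
  have h1 : Continuous fun T : V →L[ℂ] V => T (D.e i) :=
    (ContinuousLinearMap.apply ℂ _ (D.e i)).continuous
  exact isClosed_eq h1 ((D.functional.continuous.comp h1).smul continuous_const)

/-- A diagonal operator that is an absolutely convergent combination of a contractive group of
diagonal operators, with eigenvalues bounded away from zero, is bounded below. -/
lemma exists_norm_sum_le [CompleteSpace V] {Γ : Type*} [AddCommGroup Γ]
    {τ : Multiplicative Γ →* (V →L[ℂ] V)} (hτ : ∀ γ, ‖τ γ‖ ≤ 1) {χ : ι → Multiplicative Γ → ℂ}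
    (hχ : ∀ γ i, τ γ (D.e i) = χ i γ • D.e i) {ν : Multiplicative Γ → ℂ}
    (hν : Summable fun γ => ‖ν γ‖) {ε : ℝ} (hε : 0 < ε) {m : ι → ℂ}
    (hm : ∀ i, m i = ∑' γ, ν γ * χ i γ) (hle : ∀ i, ε ≤ ‖m i‖) :
    ∃ G : ℝ, 0 ≤ G ∧ ∀ (s : Finset ι) (c : ι → ℂ),
      ‖∑ i ∈ s, c i • D.e i‖ ≤ G * ‖∑ i ∈ s, (c i * m i) • D.e i‖ := by
  let τD : Multiplicative Γ →* D.diagonal := τ.codRestrict D.diagonal fun γ i => by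
    rw [hχ, map_smul, D.functional_e, smul_eq_mul, mul_one]
  have hτD (γ) : ‖τD γ‖ ≤ 1 := hτ γ
  have heig (i γ) : D.eigenvalue i (τD γ) = χ i γ := by
    change D.functional (τ γ (D.e i)) = _
    rw [hχ, map_smul, D.functional_e, smul_eq_mul, mul_one]
  set M : D.diagonal := ∑' γ, ν γ • τD γ with hM_def
  have hM (i) : D.eigenvalue i M = m i := by
    rw [hM_def, algHom_tsum _ (summable_smul_of_contractive hν hτD), hm i]
    simp only [heig]
  obtain ⟨a, ha⟩ : IsUnit M := isUnit_tsum_smul_of_le_norm hτD D.eigenvalue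
    (fun T h => D.diagonal_ext fun i => by rw [h, map_zero]) hν hε fun i => by
      rw [hM]; exact hle i
  refine ⟨‖(a⁻¹.1).1‖, norm_nonneg _, fun s c => ?_⟩
  have hMP : M.1 (∑ i ∈ s, c i • D.e i) = ∑ i ∈ s, (c i * m i) • D.e i := by
    rw [map_sum]
    refine Finset.sum_congr rfl fun i _ => ?_
    rw [map_smul, diagonal_apply, hM, smul_smul]
  have hinv (P : V) : (a⁻¹.1).1 (M.1 P) = P := by
    change ((a⁻¹.1) * M).1 P = P
    rw [← ha, Units.inv_mul]
    rfl
  rw [← hMP]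
  conv_lhs => rw [← hinv (∑ i ∈ s, c i • D.e i)]
  exact ContinuousLinearMap.le_opNorm _ _

end NormalizedSystem

/-- The closed span of a family of vectors, normalized by a functional on the ambient space. -/
noncomputable def NormalizedSystem.ofFamily {e : ι → V} {l : V →L[ℂ] ℂ} (hl : ∀ i, l (e i) = 1) :
    NormalizedSystem ι (Submodule.span ℂ (Set.range e)).topologicalClosure where
  e i := ⟨e i, Submodule.le_topologicalClosure _ (Submodule.subset_span ⟨i, rfl⟩)⟩
  functional := l.comp (Submodule.subtypeL _)
  functional_e := hl
  dense := by
    rw [← Submodule.dense_iff_topologicalClosure_eq_top, Subtype.dense_iff]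
    intro f hf
    refine closure_mono (fun g hg => ?_) hf
    refine Submodule.span_le (p := (Submodule.span ℂ (Set.range _)).map
      (Submodule.subtype _)) |>.mpr ?_ hg
    rintro _ ⟨i, rfl⟩
    exact ⟨_, Submodule.subset_span ⟨i, rfl⟩, rfl⟩

lemma mapsTo_topologicalClosure_span {e : ι → V} {T : V →L[ℂ] V} {c : ι → ℂ}
    (h : ∀ i, T (e i) = c i • e i) :
    Set.MapsTo T (Submodule.span ℂ (Set.range e)).topologicalClosure
      (Submodule.span ℂ (Set.range e)).topologicalClosure := by
  intro f hf
  refine map_mem_closure T.continuous hf fun g hg => ?_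
  change T g ∈ Submodule.span ℂ (Set.range e)
  induction hg using Submodule.span_induction with
  | mem x hx =>
    obtain ⟨i, rfl⟩ := hx
    rw [h]
    exact Submodule.smul_mem _ _ (Submodule.subset_span ⟨i, rfl⟩)
  | zero => simp
  | add x y _ _ hx hy => rw [map_add]; exact add_mem hx hy
  | smul a x _ hx => rw [map_smul]; exact Submodule.smul_mem _ _ hx

/-- Let a group of contractions have common eigenvectors `e i`. An absolutely convergent
combination of these contractions whose eigenvalues are bounded away from zero is bounded below on
the span of the `e i`. -/
theorem exists_norm_sum_le_of_eigenvectors [CompleteSpace V] {Γ : Type*} [AddCommGroup Γ]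
    {e : ι → V} {l : V →L[ℂ] ℂ} (hl : ∀ i, l (e i) = 1)
    {τ : Multiplicative Γ →* (V →L[ℂ] V)} (hτ : ∀ γ, ‖τ γ‖ ≤ 1) {χ : ι → Multiplicative Γ → ℂ}
    (hχ : ∀ γ i, τ γ (e i) = χ i γ • e i) {ν : Multiplicative Γ → ℂ}
    (hν : Summable fun γ => ‖ν γ‖) {ε : ℝ} (hε : 0 < ε) {m : ι → ℂ}
    (hm : ∀ i, m i = ∑' γ, ν γ * χ i γ) (hle : ∀ i, ε ≤ ‖m i‖) :
    ∃ G : ℝ, 0 ≤ G ∧ ∀ (s : Finset ι) (c : ι → ℂ),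
      ‖∑ i ∈ s, c i • e i‖ ≤ G * ‖∑ i ∈ s, (c i * m i) • e i‖ := by
  have : CompleteSpace (Submodule.span ℂ (Set.range e)).topologicalClosure :=
    (Submodule.isClosed_topologicalClosure _).completeSpace_coe
  let D := NormalizedSystem.ofFamily hl
  let σ : Multiplicative Γ →* ((Submodule.span ℂ (Set.range e)).topologicalClosure →L[ℂ]
      (Submodule.span ℂ (Set.range e)).topologicalClosure) :=
    { toFun γ := (τ γ).restrict (mapsTo_topologicalClosure_span (hχ γ))
      map_one' := by
        ext f
        change τ 1 f.1 = f.1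
        rw [map_one]
        rfl
      map_mul' γ γ' := by
        ext f
        change τ (γ * γ') f.1 = τ γ (τ γ' f.1)
        rw [map_mul]
        rfl }
  have hσ (γ) : ‖σ γ‖ ≤ 1 := ContinuousLinearMap.opNorm_le_bound _ zero_le_one fun f =>
    ((τ γ).le_of_opNorm_le (hτ γ) f.1)
  obtain ⟨G, hG0, hG⟩ := D.exists_norm_sum_le hσ (χ := χ) (fun γ i => Subtype.ext (hχ γ i))
    hν hε hm hle
  refine ⟨G, hG0, fun s c => ?_⟩
  have h (b : ι → ℂ) : ‖∑ i ∈ s, b i • D.e i‖ = ‖∑ i ∈ s, b i • e i‖ := by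
    change ‖((∑ i ∈ s, b i • D.e i :
      (Submodule.span ℂ (Set.range e)).topologicalClosure) : V)‖ = _
    rw [Submodule.coe_sum]
    rfl
  rw [← h, ← h]
  exact hG s c

end Diagonal

/-! ### Translations acting on bounded continuous functions -/

/-- The exponential of frequency `u` as a bounded continuous function. -/
noncomputable def waveBCF (u : E d) : E d →ᵇ ℂ :=
  .ofNormedAddCommGroup (wave u) (contDiff_wave u (n := 0)).continuous 1 fun x => (norm_wave u x).le

@[simp] lemma waveBCF_apply (u x : E d) : waveBCF u x = wave u x := rfl

/-- The translations of bounded continuous functions. -/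
noncomputable def translateBCF : Multiplicative (E d) →* ((E d →ᵇ ℂ) →L[ℂ] (E d →ᵇ ℂ)) where
  toFun γ := BoundedContinuousFunction.compContinuousCLM ℂ ℂ ⟨fun x => x + γ.toAdd, by fun_prop⟩
  map_one' := by
    ext f x
    change f (x + 0) = f x
    rw [add_zero]
  map_mul' γ γ' := by
    ext f x
    change f (x + (γ.toAdd + γ'.toAdd)) = f (x + γ.toAdd + γ'.toAdd)
    rw [add_assoc]

lemma translateBCF_apply (γ : Multiplicative (E d)) (x : E d) (f : E d →ᵇ ℂ) :
    translateBCF γ f x = f (x + γ.toAdd) := rfl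

lemma norm_translateBCF_le (γ : Multiplicative (E d)) : ‖translateBCF γ‖ ≤ 1 := by
  refine ContinuousLinearMap.opNorm_le_bound _ zero_le_one fun f => ?_
  rw [one_mul, BoundedContinuousFunction.norm_le (norm_nonneg _)]
  exact fun x => f.norm_coe_le_norm _

lemma translateBCF_waveBCF (γ : Multiplicative (E d)) (u : E d) :
    translateBCF γ (waveBCF u) = wave u γ.toAdd • waveBCF u := by
  ext x
  simp [translateBCF_apply, wave_add, mul_comm]

/-- The multiplier `m` is the operator `∑ ν γ • translateBCF γ` on the closed span of the
exponentials of `U`; evaluation at `0` is the normalizing functional. Restricting to this span is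
what allows the lower bound on `m` to be assumed on `U` only. -/
lemma exists_norm_sum_le_of_multiplier {U : Set (E d)} {ν : E d → ℂ}
    (hν : Summable fun γ => ‖ν γ‖) {ε : ℝ} (hε : 0 < ε) {m : E d → ℂ}
    (hm : ∀ u ∈ U, m u = ∑' γ, ν γ * wave u γ) (hle : ∀ u ∈ U, ε ≤ ‖m u‖) :
    ∃ G : ℝ, 0 ≤ G ∧ ∀ (s : Finset (E d)) (c : E d → ℂ) (N : ℝ), (∀ u ∈ s, u ∈ U) →
      (∀ x, ‖∑ u ∈ s, c u * (m u * wave u x)‖ ≤ N) → ∀ x, ‖∑ u ∈ s, c u * wave u x‖ ≤ G * N := by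
  classical
  have hl (u : U) : BoundedContinuousFunction.evalCLM ℂ (0 : E d) (waveBCF (u : E d)) = 1 :=
    wave_zero _
  have hν' : Summable fun γ : Multiplicative (E d) => ‖ν γ.toAdd‖ :=
    (Multiplicative.toAdd.summable_iff (f := fun γ => ‖ν γ‖)).mpr hν
  have hm' (u : U) : m u = ∑' γ : Multiplicative (E d), ν γ.toAdd * wave u γ.toAdd :=
    (hm u u.2).trans (Multiplicative.toAdd.tsum_eq fun γ => ν γ * wave u γ).symm
  obtain ⟨G, hG0, hG⟩ := exists_norm_sum_le_of_eigenvectors hl norm_translateBCF_le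
    (χ := fun u γ => wave u γ.toAdd) (fun γ u => translateBCF_waveBCF γ u) hν' hε hm'
    fun u => hle u u.2
  refine ⟨G, hG0, fun s c N hs hN x => ?_⟩
  have happly (b : E d → ℂ) (y : E d) :
      (∑ u ∈ s.subtype (· ∈ U), b u • waveBCF (u : E d)) y = ∑ u ∈ s, b u * wave u y := by
    rw [BoundedContinuousFunction.coe_sum, Finset.sum_apply]
    exact Finset.sum_subtype_of_mem (fun u => b u * wave u y) hs
  have hN0 : 0 ≤ N := (norm_nonneg _).trans (hN 0)
  rw [← happly]
  refine (BoundedContinuousFunction.norm_coe_le_norm _ x).trans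
    ((hG (s.subtype (· ∈ U)) fun u => c u).trans (mul_le_mul_of_nonneg_left ?_ hG0))
  refine (BoundedContinuousFunction.norm_le hN0).mpr fun y => ?_
  rw [happly fun u => c u * m u]
  simpa only [mul_assoc] using hN y

/-! ### From a ball to the whole space, and almost periodicity -/

open Filter Topology

lemma isExpSum_iff {U : Set (E d)} {P : E d → ℂ} : IsExpSum U P ↔
    ∃ (s : Finset (E d)) (c : E d → ℂ), (∀ u ∈ s, u ∈ U) ∧ ∀ x, P x = ∑ u ∈ s, c u * wave u x := by
  simp only [IsExpSum, wave]

lemma IsExpSum.sub {U : Set (E d)} {P Q : E d → ℂ} (hP : IsExpSum U P) (hQ : IsExpSum U Q) :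
    IsExpSum U (P - Q) := by
  classical
  obtain ⟨s, c, hs, hP⟩ := isExpSum_iff.mp hP
  obtain ⟨t, b, ht, hQ⟩ := isExpSum_iff.mp hQ
  refine isExpSum_iff.mpr ⟨s ∪ t, fun u => (if u ∈ s then c u else 0) - if u ∈ t then b u else 0,
    fun u hu => (Finset.mem_union.mp hu).elim (hs u) (ht u), fun x => ?_⟩
  simp only [Pi.sub_apply, hP, hQ, sub_mul, Finset.sum_sub_distrib, ite_mul, zero_mul,
    Finset.sum_ite_mem]
  rw [Finset.union_inter_cancel_left, Finset.union_inter_cancel_right]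

/-- On exponential sums with frequencies in `U`, the sup norm of the whole space is controlled by
the one of a ball. -/
lemma exists_norm_expSum_le {μ μhat : AtomicMeasure d} {T : 𝓢'(E d, ℂ)}
    (hμhat : μhat.TranslationBounded) (hT : μ.IsDistribution T)
    (hThat : μhat.IsDistribution (FourierTransform.fourier T))
    {U : Set (E d)} {ε : ℝ} (hε : 0 < ε) (hmass : ∀ x ∈ U, ε ≤ ‖μ.coeff x‖)
    (hsep : ∀ x ∈ U, ∀ y ∈ μ.carrier \ {x}, ε ≤ dist x y) :
    ∃ R C : ℝ, 0 ≤ R ∧ 0 ≤ C ∧ ∀ (P : E d → ℂ) (M : ℝ), IsExpSum U P →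
      (∀ y, ‖y‖ ≤ R → ‖P y‖ ≤ M) → ∀ x, ‖P x‖ ≤ C * M := by
  obtain ⟨κ, hκ⟩ := exists_schwartz_hasSum hT hThat hε hsep
  obtain ⟨A, hA0, hA⟩ := exists_norm_sum_coeff_le hμhat hκ
  obtain ⟨G, hG0, hG⟩ := exists_norm_sum_le_of_multiplier (m := μ.coeff)
    (summable_norm_coeff_mul_schwartz hμhat κ) hε
    (fun u hu => by simpa using (hκ u hu 0).tsum_eq.symm) hmass
  -- With `R = 2GA` the global term `G * A * (N / (1 + R))` is at most `N / 2`. It can be absorbed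
  -- because `N`, the supremum of a finite exponential sum, is finite.
  refine ⟨2 * (G * A), 2 * (G * A), by positivity, by positivity, fun P M hP hM x => ?_⟩
  obtain ⟨s, c, hs, hPs⟩ := isExpSum_iff.mp hP
  have hbdd : BddAbove (Set.range fun x => ‖P x‖) := by
    refine ⟨∑ u ∈ s, ‖c u‖, ?_⟩
    rintro _ ⟨x, rfl⟩
    simp only [hPs]
    refine (norm_sum_le _ _).trans_eq ?_
    simp
  set N := ⨆ x, ‖P x‖
  have hN (x) : ‖P x‖ ≤ N := le_ciSup hbdd x
  have hN0 : 0 ≤ N := (norm_nonneg _).trans (hN 0)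
  have hGA : 0 ≤ G * A := by positivity
  have h1 : N ≤ G * (A * (M + N / (1 + 2 * (G * A)))) := by
    refine ciSup_le fun x => ?_
    rw [hPs]
    refine hG s c _ hs (hA _ M N s c (by positivity) hs (fun y hy => ?_) fun y => ?_) x
    · rw [← hPs]; exact hM y hy
    · rw [← hPs]; exact hN y
  have h2 : G * A * (N / (1 + 2 * (G * A))) ≤ N / 2 := by
    rw [mul_div_assoc', div_le_div_iff₀ (by positivity) two_pos]
    nlinarith
  linarith [hN x]

/-- Finitely many exponentials have a relatively dense set of common almost periods. -/
lemma exists_common_almost_period (s : Finset (E d)) {η : ℝ} (hη : 0 < η) :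
    ∃ R : ℝ, 0 < R ∧ ∀ a : E d, ∃ τ ∈ Metric.ball a R, ∀ u ∈ s, ‖wave u τ - 1‖ ≤ η := by
  let Φ : E d → s → ℂ := fun x u => wave (u : E d) x
  have hb : TotallyBounded (Set.range Φ) := by
    refine ((isCompact_closedBall (0 : s → ℂ) 1).totallyBounded).subset ?_
    rintro _ ⟨x, rfl⟩
    rw [mem_closedBall_zero_iff, pi_norm_le_iff_of_nonneg zero_le_one]
    exact fun u => (norm_wave _ _).le
  obtain ⟨t, ht, htf, hcov⟩ := Metric.finite_approx_of_totallyBounded hb η hη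
  have hpre : ∀ y ∈ t, ∃ x, Φ x = y := fun y hy => ht hy
  choose! g hg using hpre
  -- Finitely many points `g y` approximate every value of `Φ` within `η`. If `Φ a` is close to `Φ
  -- (g y)`, then `a - g y` is a common almost period, at distance `‖g y‖` from `a`.
  refine ⟨1 + ∑ y ∈ htf.toFinset, ‖g y‖, by positivity, fun a => ?_⟩
  obtain ⟨y, hy, hya⟩ := Set.mem_iUnion₂.mp (hcov ⟨a, rfl⟩)
  refine ⟨a - g y, ?_, fun u hu => ?_⟩
  · rw [Metric.mem_ball, dist_eq_norm, sub_sub_cancel_left, norm_neg]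
    have := Finset.single_le_sum (f := fun y => ‖g y‖) (fun _ _ => norm_nonneg _)
      (htf.mem_toFinset.mpr hy)
    linarith
  · have h1 : dist (wave u a) (wave u (g y)) < η := by
      rw [← hg y hy] at hya
      exact (dist_le_pi_dist (Φ a) (Φ (g y)) ⟨u, hu⟩).trans_lt hya
    have h2 : wave u a - wave u (g y) = wave u (g y) * (wave u (a - g y) - 1) := by
      rw [mul_sub, ← wave_add, add_sub_cancel, mul_one]
    rw [dist_eq_norm, h2, norm_mul, norm_wave, one_mul] at h1
    exact h1.le

lemma IsExpSum.exists_almost_period {U : Set (E d)} {P : E d → ℂ} (hP : IsExpSum U P) {η : ℝ}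
    (hη : 0 < η) : ∃ R : ℝ, 0 < R ∧ ∀ a : E d, ∃ τ ∈ Metric.ball a R,
      ∀ x : E d, ‖P (x + τ) - P x‖ ≤ η := by
  obtain ⟨s, c, -, hPs⟩ := isExpSum_iff.mp hP
  set C := ∑ u ∈ s, ‖c u‖
  have hC : 0 ≤ C := Finset.sum_nonneg fun _ _ => norm_nonneg _
  obtain ⟨R, hR, h⟩ := exists_common_almost_period s (η := η / (C + 1)) (by positivity)
  refine ⟨R, hR, fun a => ?_⟩
  obtain ⟨τ, hτ, hτs⟩ := h a
  refine ⟨τ, hτ, fun x => ?_⟩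
  rw [hPs, hPs, ← Finset.sum_sub_distrib]
  calc _ ≤ ∑ u ∈ s, ‖c u‖ * (η / (C + 1)) := by
        refine norm_sum_le_of_le _ fun u hu => ?_
        rw [wave_add, show c u * (wave u x * wave u τ) - c u * wave u x =
          c u * (wave u x * (wave u τ - 1)) by ring, norm_mul, norm_mul, norm_wave, one_mul]
        exact mul_le_mul_of_nonneg_left (hτs u hu) (norm_nonneg _)
    _ = C * (η / (C + 1)) := by rw [Finset.sum_mul]
    _ ≤ η := by
        rw [mul_div_assoc', div_le_iff₀ (by positivity)]
        nlinarith

lemma IsExpSum.continuous {U : Set (E d)} {P : E d → ℂ} (hP : IsExpSum U P) : Continuous P := by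
  obtain ⟨s, c, -, hPs⟩ := isExpSum_iff.mp hP
  rw [funext hPs]
  exact continuous_finsetSum _ fun u _ =>
    continuous_const.mul (contDiff_wave u (n := 0)).continuous

lemma isBohrAlmostPeriodic_of_tendstoUniformly {U : Set (E d)} {P : ℕ → E d → ℂ} {f : E d → ℂ}
    (hP : ∀ n, IsExpSum U (P n)) (h : TendstoUniformly P f atTop) : IsBohrAlmostPeriodic f := by
  refine ⟨h.continuous (.of_forall fun n => (hP n).continuous), fun η hη => ?_⟩
  obtain ⟨n, hn⟩ := (Metric.tendstoUniformly_iff.mp h (η / 3) (by positivity)).exists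
  obtain ⟨R, hR, hap⟩ := (hP n).exists_almost_period (η := η / 3) (by positivity)
  refine ⟨R, hR, fun a => ?_⟩
  obtain ⟨τ, hτ, hτP⟩ := hap a
  refine ⟨τ, hτ, fun x => ?_⟩
  have h1 := hn (x + τ)
  have h2 := hn x
  have h3 := hτP x
  rw [← dist_eq_norm] at h3 ⊢
  have h4 := dist_triangle4 (f (x + τ)) (P n (x + τ)) (P n x) (f x)
  rw [dist_comm (P n x) (f x)] at h4
  linarith

/-- If the sup norm of exponential sums with frequencies in `U` is controlled by the one of a ball,
then limits that are uniform on that ball and pointwise elsewhere are uniform. -/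
lemma tendstoUniformly_of_norm_expSum_le {U : Set (E d)} {R C : ℝ} (hC : 0 ≤ C)
    (hRC : ∀ (P : E d → ℂ) (M : ℝ), IsExpSum U P →
      (∀ y, ‖y‖ ≤ R → ‖P y‖ ≤ M) → ∀ x, ‖P x‖ ≤ C * M)
    {P : ℕ → E d → ℂ} {f : E d → ℂ} (hP : ∀ n, IsExpSum U (P n))
    (hball : TendstoUniformlyOn P f atTop (Metric.closedBall 0 R))
    (hlim : ∀ x, Tendsto (fun n => P n x) atTop (𝓝 (f x))) : TendstoUniformly P f atTop := by
  rw [Metric.tendstoUniformly_iff]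
  intro η hη
  set ρ := η / (2 * (C + 1)) with hρ_def
  have hρ : 0 < ρ := by positivity
  obtain ⟨N, hN⟩ := eventually_atTop.mp (Metric.tendstoUniformlyOn_iff.mp hball (ρ / 2)
    (by positivity))
  filter_upwards [eventually_ge_atTop N] with n hn x
  -- The difference of two terms is again an exponential sum over `U`, so being Cauchy on the ball
  -- gives being Cauchy uniformly on the space; letting `m` tend to infinity replaces `P m` by `f`.
  have h1 : ∀ m ≥ N, dist (P m x) (P n x) ≤ C * ρ := fun m hm => by
    rw [dist_eq_norm]
    refine hRC (P m - P n) ρ ((hP m).sub (hP n)) (fun y hy => ?_) x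
    have hy' : y ∈ Metric.closedBall (0 : E d) R := mem_closedBall_zero_iff.mpr hy
    rw [Pi.sub_apply, ← dist_eq_norm]
    have := dist_triangle_left (P m y) (P n y) (f y)
    linarith [hN m hm y hy', hN n hn y hy']
  have h2 : dist (f x) (P n x) ≤ C * ρ :=
    le_of_tendsto ((hlim x).dist tendsto_const_nhds) (eventually_atTop.mpr ⟨N, h1⟩)
  refine h2.trans_lt ?_
  rw [hρ_def, mul_div_assoc', div_lt_iff₀ (by positivity)]
  nlinarith

end Quasicrystal

theorem mainTheorem1 (d : ℕ) (μ μhat : Quasicrystal.AtomicMeasure d)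
    (T : TemperedDistribution (Quasicrystal.E d) ℂ)
    (hμ : μ.TranslationBounded) (hμhat : μhat.TranslationBounded)
    (hT : μ.IsDistribution T)
    (hThat : μhat.IsDistribution (FourierTransform.fourier T))
    (U : Set (Quasicrystal.E d)) (hU : U ⊆ μ.carrier) (ε : ℝ) (hε : 0 < ε)
    (hmass : ∀ x ∈ U, ε ≤ ‖μ.coeff x‖)
    (hsep : ∀ x ∈ U, ∀ y ∈ μ.carrier \ {x}, ε ≤ dist x y) :
    Quasicrystal.IsCoherentSetOfFrequencies U := by
  refine ⟨⟨ε, hε, fun x hx y hy hxy => hsep x hx y ⟨hU hy, fun h => hxy h.symm⟩⟩,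
    fun P f hP hlim => ?_⟩
  obtain ⟨R, C, -, hC, hRC⟩ :=
    Quasicrystal.exists_norm_expSum_le hμhat hT hThat hε hmass hsep
  refine Quasicrystal.isBohrAlmostPeriodic_of_tendstoUniformly hP
    (Quasicrystal.tendstoUniformly_of_norm_expSum_le hC hRC hP
      (hlim _ (isCompact_closedBall 0 R)) fun x => ?_)
  exact (hlim {x} isCompact_singleton).tendsto_at rfl
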